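/- Let $\eta \ge 0$ and let $j = j(n)$ be a nondecreasing function of $n$ with values in the nonnegative integers such that $j(n) \ge (e\cdot e^{1/e}+\eta)\sqrt{n}$ for all sufficiently large $n$. For every $n$ let $\tau_n$ be a permutation of $\{1,\dots,j(n)\}$ (the pattern), let $\Sigma_n$ be a uniformly distributed random permutation of $\{1,\dots,n\}$, and let $\Gamma_n$ be the set of all $j(n)$-element subsets of $\{1,\dots,n\}$ (empty if $j(n)>n$). For $\alpha=\{i_1<\dots<i_{j(n)}\}\in\Gamma_n$ let $X_\alpha\in\{0,1\}$ be the indicator of the event that $\Sigma_n(i_1)\cdots\Sigma_n(i_{j(n)})$ has the same relative order as $\tau_n$, that is, that replacing its $k$-th smallest entry by $k$, for each $k$, gives $\tau_n$. Put $\mathbb{X}_n=(X_\alpha)_{\alpha\in\Gamma_n}$, and let $\mathbb{B}_n=(B_\alpha)_{\alpha\in\Gamma_n}$ be a family of independent $\{0,1\}$-valued random variables with $\mathbb{E}B_\alpha=\mathbb{E}X_\alpha$ for all $\alpha\in\Gamma_n$. Then for every sequence of measurable functions $h_n:\{0,1\}^{\Gamma_n}\to\mathbb{R}$ and every Borel set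 $A\subseteq\mathbb{R}$, $$\mathbb{P}(h_n(\mathbb{X}_n)\in A)=\mathbb{P}(h_n(\mathbb{B}_n)\in A)+o(1)\qquad(n\to\infty),$$ and the total variation distance $\sup_{F\subseteq\{0,1\}^{\Gamma_n}}|\mathbb{P}(\mathbb{X}_n\in F)-\mathbb{P}(\mathbb{B}_n\in F)|$ tends to $0$ as $n\to\infty$. -/

import Mathlib

open MeasureTheory ProbabilityTheory Filter Asymptotics

/-- The reduction `red(w)` of a word `w = w₁ ⋯ w_k` with distinct letters: the permutation of
the `k` positions obtained by replacing the `i`-th smallest letter by `i`. -/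
noncomputable def reduction {k : ℕ} {β : Type*} [LinearOrder β] (w : Fin k ↪ β) : Equiv.Perm (Fin k) :=
  Equiv.ofBijective
    (fun i => ((Finset.univ.map w).orderIsoOfFin (by simp)).symm ⟨w i, by simp⟩)
    (Finite.injective_iff_bijective.mp fun a b h => by simpa using h)

theorem reduction_lt_iff {k : ℕ} {β : Type*} [LinearOrder β] (w : Fin k ↪ β) (a b : Fin k) :
    reduction w a < reduction w b ↔ w a < w b := by
  simp [reduction]

/-- `Γ_j`: the `j`-element subsets of the `n` positions (empty when `j > n`). -/
abbrev PatternIndex (n j : ℕ) : Type := {α : Finset (Fin n) // α.card = j}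

/-- The word `σ(i₁) ⋯ σ(i_j)` read from `σ` at the positions `α = {i₁ < ⋯ < i_j}`. -/
def subword {n j : ℕ} (σ : Equiv.Perm (Fin n)) (α : PatternIndex n j) : Fin j ↪ Fin n :=
  (α.1.orderEmbOfFin α.2).toEmbedding.trans σ.toEmbedding

/-- The family of indicators that `σ` shows the pattern `τ` at the positions `α`, `α ∈ Γ_j`. -/
noncomputable def patternIndicators {n j : ℕ} (τ : Equiv.Perm (Fin j)) (σ : Equiv.Perm (Fin n)) :
    PatternIndex n j → Fin 2 :=
  fun α => if reduction (subword σ α) = τ then 1 else 0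

/-- `S` is a uniform random permutation of `n` letters under `P`. -/
def IsUniformPermutation {Ω : Type*} [MeasurableSpace Ω] (P : Measure Ω) {n : ℕ}
    (S : Ω → Equiv.Perm (Fin n)) : Prop :=
  ∀ σ : Equiv.Perm (Fin n), MeasurableSet (S ⁻¹' {σ}) ∧
    P.real (S ⁻¹' {σ}) = 1 / (n.factorial : ℝ)

/-- Total variation distance between (probability) measures:
the supremum over measurable sets `s` of `|μ(s) - ν(s)|`. -/
noncomputable def tvDistance {E : Type*} [MeasurableSpace E] (μ ν : Measure E) : ℝ :=
  ⨆ s : {s : Set E // MeasurableSet s}, |μ.real s.1 - ν.real s.1|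

theorem reduction_eq_of_lt_iff {k : ℕ} {β : Type*} [LinearOrder β] (w : Fin k ↪ β)
    (π : Equiv.Perm (Fin k)) (h : ∀ a b, π a < π b ↔ w a < w b) : reduction w = π := by
  have hmono : StrictMono (π.symm.trans (reduction w)) := fun a b hab => by
    simpa [reduction_lt_iff, ← h] using hab
  have hid : ⇑(π.symm.trans (reduction w)) = id := by
    have := Subsingleton.elim
      (hmono.orderIsoOfSurjective _ (π.symm.trans (reduction w)).surjective) (OrderIso.refl _)
    funext x
    exact congrArg (fun e : Fin k ≃o Fin k => e x) this
  ext x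
  have := congrFun hid (π x)
  simpa using congrArg Fin.val this

theorem reduction_comp_perm {k : ℕ} {β : Type*} [LinearOrder β] (w : Fin k ↪ β)
    (π : Equiv.Perm (Fin k)) : reduction (π.toEmbedding.trans w) = reduction w * π :=
  reduction_eq_of_lt_iff _ _ fun a b => by simp [reduction_lt_iff]

theorem subword_mul_extend {n j : ℕ} (σ : Equiv.Perm (Fin n)) (α : PatternIndex n j)
    (π : Equiv.Perm (Fin j)) :
    subword (σ * π.viaFintypeEmbedding (α.1.orderEmbOfFin α.2).toEmbedding) α =
      π.toEmbedding.trans (subword σ α) := by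
  ext i
  have := Equiv.Perm.viaFintypeEmbedding_apply_image π (α.1.orderEmbOfFin α.2).toEmbedding i
  simp only [RelEmbedding.coe_toEmbedding] at this
  simp [subword, this]

/-- Every pattern of length `j` occurs at the positions `α` in exactly `n! / j!` permutations. -/
theorem card_pattern_mul_factorial {n j : ℕ} (α : PatternIndex n j) (τ : Equiv.Perm (Fin j)) :
    (Finset.univ.filter fun σ : Equiv.Perm (Fin n) => reduction (subword σ α) = τ).card *
      j.factorial = n.factorial := by
  have hfib : ∀ π ρ : Equiv.Perm (Fin j),
      (Finset.univ.filter fun σ : Equiv.Perm (Fin n) => reduction (subword σ α) = π).card =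
      (Finset.univ.filter fun σ : Equiv.Perm (Fin n) => reduction (subword σ α) = ρ).card := by
    intro π ρ
    refine Finset.card_equiv (Equiv.mulRight
      ((π⁻¹ * ρ).viaFintypeEmbedding (α.1.orderEmbOfFin α.2).toEmbedding)) fun σ => ?_
    simp [subword_mul_extend, reduction_comp_perm, ← mul_assoc, mul_inv_eq_one]
  have hsum := Finset.card_eq_sum_card_fiberwise
    (f := fun σ : Equiv.Perm (Fin n) => reduction (subword σ α)) (s := Finset.univ)
    (t := Finset.univ) (fun _ _ => Finset.mem_coe.2 (Finset.mem_univ _))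
  rw [Finset.sum_congr rfl fun ρ _ => hfib ρ τ] at hsum
  simp only [Finset.card_univ, Fintype.card_perm, Fintype.card_fin, Finset.sum_const,
    smul_eq_mul] at hsum
  rw [hsum, mul_comm]

theorem IsUniformPermutation.measurableSet_preimage {Ω : Type*} [MeasurableSpace Ω]
    {P : Measure Ω} {n : ℕ} {S : Ω → Equiv.Perm (Fin n)} (hS : IsUniformPermutation P S)
    (s : Set (Equiv.Perm (Fin n))) : MeasurableSet (S ⁻¹' s) := by
  rw [← Set.biUnion_preimage_singleton]
  exact s.toFinite.measurableSet_biUnion fun σ _ => (hS σ).1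

theorem IsUniformPermutation.measureReal_preimage_finset {Ω : Type*} [MeasurableSpace Ω]
    {P : Measure Ω} [IsProbabilityMeasure P] {n : ℕ} {S : Ω → Equiv.Perm (Fin n)}
    (hS : IsUniformPermutation P S) (s : Finset (Equiv.Perm (Fin n))) :
    P.real (S ⁻¹' s) = s.card / (n.factorial : ℝ) := by
  have hU : S ⁻¹' (s : Set (Equiv.Perm (Fin n))) = ⋃ σ ∈ s, S ⁻¹' {σ} := by
    ext ω; simp
  rw [hU, measureReal_biUnion_finset, Finset.sum_congr rfl fun σ _ => (hS σ).2]
  · simp [div_eq_mul_inv]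
  · intro a _ b _ hab
    exact Disjoint.preimage S (by simpa using hab)
  · exact fun σ _ => (hS σ).1

theorem IsUniformPermutation.measureReal_patternIndicators_ne_zero {Ω : Type*}
    [MeasurableSpace Ω] {P : Measure Ω} [IsProbabilityMeasure P] {n j : ℕ}
    {S : Ω → Equiv.Perm (Fin n)} (hS : IsUniformPermutation P S) (τ : Equiv.Perm (Fin j))
    (α : PatternIndex n j) :
    P.real {ω | patternIndicators τ (S ω) α ≠ 0} = 1 / (j.factorial : ℝ) := by
  have hset : {ω | patternIndicators τ (S ω) α ≠ 0} = S ⁻¹' (Finset.univ.filter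
      fun σ : Equiv.Perm (Fin n) => reduction (subword σ α) = τ : Finset _) := by
    ext ω; simp [patternIndicators]
  rw [hset, hS.measureReal_preimage_finset, div_eq_div_iff (by positivity) (by positivity), one_mul]
  exact_mod_cast card_pattern_mul_factorial α τ

theorem IsUniformPermutation.measurable_patternIndicators {Ω : Type*} [MeasurableSpace Ω]
    {P : Measure Ω} {n j : ℕ} {S : Ω → Equiv.Perm (Fin n)} (hS : IsUniformPermutation P S)
    (τ : Equiv.Perm (Fin j)) : Measurable fun ω => patternIndicators τ (S ω) :=
  fun s _ => hS.measurableSet_preimage (patternIndicators τ ⁻¹' s)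

theorem integral_fin_two_eq_measureReal {Ω : Type*} [MeasurableSpace Ω] (μ : Measure Ω)
    {f : Ω → Fin 2} (hf : Measurable f) :
    ∫ ω, ((f ω : ℕ) : ℝ) ∂μ = μ.real {ω | f ω ≠ 0} := by
  have hs : MeasurableSet {ω | f ω ≠ 0} := hf (MeasurableSet.of_discrete (s := {x | x ≠ 0}))
  rw [← integral_indicator_one hs]
  congr 1
  funext ω
  by_cases h : f ω = 0
  · simp [h]
  · have h1 : f ω = 1 := Fin.eq_one_of_ne_zero _ h
    simp [h1]

theorem measureReal_ne_zero_le_sum {Ω ι κ : Type*} [MeasurableSpace Ω] (μ : Measure Ω)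
    [IsFiniteMeasure μ] [Fintype ι] [Zero κ] (f : Ω → ι → κ) :
    μ.real {ω | f ω ≠ 0} ≤ ∑ i, μ.real {ω | f ω i ≠ 0} := by
  have hU : {ω | f ω ≠ 0} = ⋃ i ∈ (Finset.univ : Finset ι), {ω | f ω i ≠ 0} := by
    ext ω; simp [Function.ne_iff]
  rw [hU]
  exact measureReal_biUnion_finset_le _ _

/-- Two random elements that are each zero with high probability are close in law. -/
theorem abs_measureReal_preimage_sub_le {Ω Ω' E : Type*} [MeasurableSpace Ω]
    [MeasurableSpace Ω'] (μ : Measure Ω) (ν : Measure Ω') [IsProbabilityMeasure μ]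
    [IsProbabilityMeasure ν] [Zero E] (f : Ω → E) (g : Ω' → E) (F : Set E)
    (hf : MeasurableSet (f ⁻¹' F)) (hg : MeasurableSet (g ⁻¹' F)) :
    |μ.real (f ⁻¹' F) - ν.real (g ⁻¹' F)| ≤ μ.real {ω | f ω ≠ 0} + ν.real {ω | g ω ≠ 0} := by
  by_cases h0 : (0 : E) ∈ F
  · have h1 : μ.real (f ⁻¹' F)ᶜ ≤ μ.real {ω | f ω ≠ 0} :=
      measureReal_mono fun ω hω h => hω (by simpa [h] using h0)
    have h2 : ν.real (g ⁻¹' F)ᶜ ≤ ν.real {ω | g ω ≠ 0} :=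
      measureReal_mono fun ω hω h => hω (by simpa [h] using h0)
    rw [probReal_compl_eq_one_sub hf] at h1
    rw [probReal_compl_eq_one_sub hg] at h2
    have h3 : μ.real (f ⁻¹' F) ≤ 1 := measureReal_le_one
    have h4 : ν.real (g ⁻¹' F) ≤ 1 := measureReal_le_one
    rw [abs_le]
    constructor <;> linarith
  · have h1 : μ.real (f ⁻¹' F) ≤ μ.real {ω | f ω ≠ 0} :=
      measureReal_mono fun ω hω h => h0 (by simpa [h] using hω)
    have h2 : ν.real (g ⁻¹' F) ≤ ν.real {ω | g ω ≠ 0} :=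
      measureReal_mono fun ω hω h => h0 (by simpa [h] using hω)
    have h3 : 0 ≤ μ.real (f ⁻¹' F) := measureReal_nonneg
    have h4 : 0 ≤ ν.real (g ⁻¹' F) := measureReal_nonneg
    rw [abs_le]
    constructor <;> linarith

/-- If `C √n ≤ j`, the expected number `binom(n, j) / j!` of occurrences of a pattern of length `j`
in a uniform random permutation of `n` letters is at most `(e / C) ^ (2 j)`. -/
theorem choose_div_factorial_le {C : ℝ} (hC : 0 < C) {n j : ℕ} (hj : C * √n ≤ j) :
    (n.choose j : ℝ) / j.factorial ≤ ((Real.exp 1 / C) ^ 2) ^ j := by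
  have hfac : (0 : ℝ) < j.factorial := by positivity
  have hexp : (j : ℝ) ^ j / j.factorial ≤ Real.exp 1 ^ j := by
    simpa using Real.pow_div_factorial_le_exp (j : ℝ) (by positivity) j
  have hn : (n : ℝ) ≤ (j / C) ^ 2 := by
    rw [← Real.sq_sqrt (Nat.cast_nonneg n)]
    gcongr
    rwa [le_div_iff₀' hC]
  calc (n.choose j : ℝ) / j.factorial
      ≤ (n : ℝ) ^ j / j.factorial / j.factorial := by
        gcongr
        exact Nat.choose_le_pow_div j n
    _ ≤ ((j / C) ^ 2) ^ j / j.factorial / j.factorial := by gcongr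
    _ = ((j : ℝ) ^ j / j.factorial) ^ 2 / (C ^ j) ^ 2 := by
        rw [← pow_mul, mul_comm 2 j, pow_mul, div_pow]
        field_simp
    _ ≤ (Real.exp 1 ^ j) ^ 2 / (C ^ j) ^ 2 := by gcongr
    _ = ((Real.exp 1 / C) ^ 2) ^ j := by
        rw [← div_pow, ← div_pow, ← pow_mul, ← pow_mul, mul_comm]

theorem tendsto_choose_div_factorial {C : ℝ} (hC : Real.exp 1 < C) {j : ℕ → ℕ}
    (hj : ∀ᶠ n : ℕ in atTop, C * √n ≤ j n) :
    Tendsto (fun n => (n.choose (j n) : ℝ) / (j n).factorial) atTop (nhds 0) := by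
  have hC0 : 0 < C := (Real.exp_pos 1).trans hC
  have hj_top : Tendsto j atTop atTop := by
    rw [← tendsto_natCast_atTop_iff (R := ℝ)]
    refine tendsto_atTop_mono' _ hj (Tendsto.const_mul_atTop hC0 ?_)
    exact Real.tendsto_sqrt_atTop.comp tendsto_natCast_atTop_atTop
  have hr : (Real.exp 1 / C) ^ 2 < 1 :=
    pow_lt_one₀ (by positivity) ((div_lt_one hC0).2 hC) two_ne_zero
  refine squeeze_zero' (Eventually.of_forall fun n => by positivity) ?_
    ((tendsto_pow_atTop_nhds_zero_of_lt_one (by positivity) hr).comp hj_top)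
  filter_upwards [hj] with n hn
  exact choose_div_factorial_le hC0 hn

theorem mainTheorem4
    (η : ℝ) (hη : 0 ≤ η)
    (j : ℕ → ℕ) (hj_mono : Monotone j)
    (hj : ∀ᶠ n : ℕ in atTop,
      (Real.exp 1 * Real.exp (1 / Real.exp 1) + η) * Real.sqrt n ≤ (j n : ℝ))
    -- the patterns
    (τ : ∀ n, Equiv.Perm (Fin (j n)))
    -- the uniform random permutations
    {Ω : ℕ → Type*} [∀ n, MeasurableSpace (Ω n)]
    (P : ∀ n, Measure (Ω n)) [∀ n, IsProbabilityMeasure (P n)]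
    (S : ∀ n, Ω n → Equiv.Perm (Fin n)) (hS : ∀ n, IsUniformPermutation (P n) (S n))
    -- the independent Bernoulli variables, with the same means as the indicators
    {Ω' : ℕ → Type*} [∀ n, MeasurableSpace (Ω' n)]
    (Q : ∀ n, Measure (Ω' n)) [∀ n, IsProbabilityMeasure (Q n)]
    (B : ∀ n, Ω' n → PatternIndex n (j n) → Fin 2)
    (hB_meas : ∀ n α, Measurable fun ω => B n ω α)
    (hB_indep : ∀ n, iIndepFun (fun α ω => B n ω α) (Q n))
    (hB_mean : ∀ n α, ∫ ω, ((B n ω α : ℕ) : ℝ) ∂(Q n) =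
      ∫ ω, ((patternIndicators (τ n) (S n ω) α : ℕ) : ℝ) ∂(P n)) :
    (∀ h : ∀ n, (PatternIndex n (j n) → Fin 2) → ℝ, (∀ n, Measurable (h n)) →
      ∀ A : Set ℝ, MeasurableSet A →
        (fun n => (P n).real {ω | h n (patternIndicators (τ n) (S n ω)) ∈ A} -
            (Q n).real {ω | h n (B n ω) ∈ A})
          =o[atTop] (fun _ => (1 : ℝ))) ∧
    Tendsto (fun n => tvDistance ((P n).map fun ω => patternIndicators (τ n) (S n ω))
      ((Q n).map (B n))) atTop (nhds 0) := by
  have hX_meas := fun n => (hS n).measurable_patternIndicators (τ n)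
  have hBm : ∀ n, Measurable (B n) := fun n => measurable_pi_lambda _ (hB_meas n)
  have hcard : ∀ n, (∑ _α : PatternIndex n (j n), 1 / ((j n).factorial : ℝ)) =
      (n.choose (j n) : ℝ) / (j n).factorial := fun n => by
    simp [div_eq_mul_inv]
  have hX0 : ∀ n, (P n).real {ω | patternIndicators (τ n) (S n ω) ≠ 0} ≤
      (n.choose (j n) : ℝ) / (j n).factorial := fun n => by
    refine (measureReal_ne_zero_le_sum (P n) _).trans ?_
    rw [← hcard, Finset.sum_congr rfl fun α _ =>
      (hS n).measureReal_patternIndicators_ne_zero (τ n) α]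
  have hB0 : ∀ n, (Q n).real {ω | B n ω ≠ 0} ≤
      (n.choose (j n) : ℝ) / (j n).factorial := fun n => by
    refine (measureReal_ne_zero_le_sum (Q n) _).trans ?_
    rw [← hcard]
    refine Finset.sum_le_sum fun α _ => ?_
    rw [← integral_fin_two_eq_measureReal (Q n) (hB_meas n α), hB_mean,
      integral_fin_two_eq_measureReal (P n) ((measurable_pi_iff.1 (hX_meas n)) α),
      (hS n).measureReal_patternIndicators_ne_zero]
  have hlaw : ∀ n (F : Set (PatternIndex n (j n) → Fin 2)),
      |(P n).real ((fun ω => patternIndicators (τ n) (S n ω)) ⁻¹' F) - (Q n).real (B n ⁻¹' F)| ≤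
        2 * ((n.choose (j n) : ℝ) / (j n).factorial) := fun n F => by
    have := abs_measureReal_preimage_sub_le (P n) (Q n) _ (B n) F
      (hX_meas n MeasurableSet.of_discrete) (hBm n MeasurableSet.of_discrete)
    linarith [hX0 n, hB0 n]
  have hlim : Tendsto (fun n => 2 * ((n.choose (j n) : ℝ) / (j n).factorial)) atTop (nhds 0) := by
    have hC : Real.exp 1 < Real.exp 1 * Real.exp (1 / Real.exp 1) + η := by
      have : 1 < Real.exp (1 / Real.exp 1) := Real.one_lt_exp_iff.2 (by positivity)
      nlinarith [Real.exp_pos 1]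
    simpa using (tendsto_choose_div_factorial hC hj).const_mul 2
  refine ⟨fun h _ A _ => ?_, ?_⟩
  · rw [isLittleO_one_iff]
    exact squeeze_zero_norm (fun n => hlaw n (h n ⁻¹' A)) hlim
  · refine squeeze_zero (fun n => Real.iSup_nonneg fun _ => abs_nonneg _) (fun n => ?_) hlim
    have : Nonempty {s : Set (PatternIndex n (j n) → Fin 2) // MeasurableSet s} :=
      ⟨⟨∅, MeasurableSet.empty⟩⟩
    refine ciSup_le fun s => ?_
    rw [map_measureReal_apply (hX_meas n) s.2, map_measureReal_apply (hBm n) s.2]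
    exact hlaw n s.1
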